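/- Let $G$ be a finite simple graph on $n\geqslant 1$ vertices, and let $\lambda_1\geqslant\lambda_2\geqslant\cdots\geqslant\lambda_n$ be the eigenvalues of its adjacency matrix, listed with multiplicity. The HL-index of $G$ is $$R(G)=\max\left\{\left|\lambda_{\lfloor (n+1)/2\rfloor}\right|,\ \left|\lambda_{\lceil (n+1)/2\rceil}\right|\right\}.$$ If $G$ is connected, bipartite and not regular, and its maximum degree $\Delta$ satisfies $\Delta\geqslant 3$, then $$R(G)\leqslant\sqrt{\Delta-2}.$$ -/

import Mathlib

/-- The `k`-th largest eigenvalue `λ_k` (counted from `1`, with multiplicity) of the real adjacency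
matrix of `G`; Mathlib's `eigenvalues₀` is the non-increasing list of eigenvalues, counted from
`0`. -/
noncomputable def SimpleGraph.nthEigenvalue {V : Type*} [Fintype V] [DecidableEq V]
    (G : SimpleGraph V) [DecidableRel G.Adj] (k : ℕ) (hk : 1 ≤ k ∧ k ≤ Fintype.card V) : ℝ :=
  (G.isHermitian_adjMatrix ℝ).eigenvalues₀ ⟨k - 1, by omega⟩

/-- The HL-index `R(G) = max {|λ_⌊(n+1)/2⌋|, |λ_⌈(n+1)/2⌉|}` of a graph with `n ≥ 1` vertices. The
divisions below are natural-number divisions, with `⌈(n+1)/2⌉ = ⌊(n+2)/2⌋`. -/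
noncomputable def SimpleGraph.hlIndex {V : Type*} [Fintype V] [DecidableEq V] [Nonempty V]
    (G : SimpleGraph V) [DecidableRel G.Adj] : ℝ :=
  max
    |G.nthEigenvalue ((Fintype.card V + 1) / 2)
      (by have := Fintype.card_pos (α := V); omega)|
    |G.nthEigenvalue ((Fintype.card V + 2) / 2)
      (by have := Fintype.card_pos (α := V); omega)|

/-!
Suppose that all degrees are at most `D + 2` and that the HL-index exceeds `√D`. The spectrum of a
bipartite graph is symmetric about `0`, so every eigenvalue of the adjacency matrix `A` exceeds `√D`
in absolute value and `A² - D` is a positive definite integer matrix. Its diagonal entries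
`deg v - D` lie in `{1, 2}` and its off-diagonal entries count common neighbours, so it is the Gram
matrix of linearly independent vectors of squared length `1` or `2`, and a vector of squared length
`1` splits off from the lattice they span. Let `deg e = D + 1`. Testing the form on the components
orthogonal to `e` shows that any two vertices at distance two from `e` have a common neighbour, and
that only vertices having a common neighbour with `e` can have one with two of them. So a vertex `f`
at distance two from `e` has two neighbours of degree `D + 1`; but two vertices with a common
neighbour are never both of degree `D + 1`.
-/

namespace HLIndex

section Matrix

open Matrix Polynomial
open scoped ComplexOrder

variable {n : Type*} [Fintype n] [DecidableEq n]

lemma charpoly_comp_neg_X {R : Type*} [CommRing R] (M : Matrix n n R) :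
    M.charpoly.comp (-X) = (-1) ^ Fintype.card n * (-M).charpoly := by
  have hmap : (compRingHom (-X)).mapMatrix M.charmatrix = -(-M).charmatrix := by
    ext1 i j
    by_cases hij : i = j <;> simp [hij, sub_eq_add_neg, add_comm]
  rw [charpoly, ← coe_compRingHom_apply, RingHom.map_det, hmap, det_neg, charpoly]

lemma roots_charpoly_neg {R : Type*} [CommRing R] [IsDomain R] (M : Matrix n n R) :
    (-M).charpoly.roots = M.charpoly.roots.map (-·) := by
  have hC : ((-1) ^ Fintype.card n : R[X]) = C ((-1) ^ Fintype.card n) := by simp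
  rw [← roots_comp_neg_X, charpoly_comp_neg_X, hC, roots_C_mul _ (by simp)]

lemma eq_of_antitone_of_map_univ_eq {α : Type*} [PartialOrder α] {m : ℕ} {f g : Fin m → α}
    (hf : Antitone f) (hg : Antitone g)
    (h : Finset.univ.val.map f = Finset.univ.val.map g) : f = g := by
  rw [Fin.univ_val_map, Fin.univ_val_map, Multiset.coe_eq_coe] at h
  exact List.ofFn_injective <|
    h.eq_of_pairwise' (r := (· ≥ ·)) hf.sortedGE_ofFn.pairwise hg.sortedGE_ofFn.pairwise

variable {𝕜 : Type*} [RCLike 𝕜] {A : Matrix n n 𝕜}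

lemma eigenvalues₀_rev (hA : A.IsHermitian) (h : (-A).charpoly = A.charpoly)
    (k : Fin (Fintype.card n)) : hA.eigenvalues₀ k.rev = -hA.eigenvalues₀ k := by
  have hanti : Antitone fun i : Fin (Fintype.card n) ↦ -hA.eigenvalues₀ i.rev := fun i j hij ↦
    neg_le_neg (hA.eigenvalues₀_antitone (Fin.rev_le_rev.2 hij))
  have hmap : Finset.univ.val.map (fun i : Fin _ ↦ -hA.eigenvalues₀ i.rev) =
      Finset.univ.val.map hA.eigenvalues₀ := by
    apply Multiset.map_injective (RCLike.ofReal_injective (K := 𝕜))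
    calc Multiset.map RCLike.ofReal (Finset.univ.val.map fun i : Fin _ ↦ -hA.eigenvalues₀ i.rev)
      _ = (Finset.univ.val.map Fin.revPerm).map
            (fun i ↦ -(hA.eigenvalues₀ i : 𝕜)) := by
          simp [Function.comp_def]
      _ = A.charpoly.roots.map (-·) := by
          rw [Multiset.map_univ_val_equiv, hA.roots_charpoly_eq_eigenvalues₀, Multiset.map_map]
          rfl
      _ = Multiset.map RCLike.ofReal (Finset.univ.val.map hA.eigenvalues₀) := by
          rw [← roots_charpoly_neg, h, hA.roots_charpoly_eq_eigenvalues₀, Multiset.map_map]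
  rw [← congrFun (eq_of_antitone_of_map_univ_eq hanti hA.eigenvalues₀_antitone hmap) k, neg_neg]

lemma posDef_sq_sub_smul_one (hA : A.IsHermitian) {d : ℝ}
    (hd : ∀ i, d < hA.eigenvalues i ^ 2) : (A ^ 2 - d • 1).PosDef := by
  let U := hA.eigenvectorUnitary
  have hdiag : A ^ 2 - d • 1 = Unitary.conjStarAlgAut 𝕜 _ U
      (diagonal fun i ↦ ((hA.eigenvalues i ^ 2 - d : ℝ) : 𝕜)) := by
    have hsub : (diagonal fun i ↦ ((hA.eigenvalues i ^ 2 - d : ℝ) : 𝕜)) =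
        diagonal (RCLike.ofReal ∘ hA.eigenvalues) ^ 2 - d • 1 := by
      ext1 i j
      by_cases hij : i = j <;> simp [hij, diagonal_pow, RCLike.real_smul_eq_coe_mul]
    rw [hsub, map_sub, map_pow, ← hA.spectral_theorem, ← algebraMap_smul 𝕜 d, map_smul, map_one]
  rw [hdiag, Unitary.conjStarAlgAut_apply,
    IsUnit.posDef_star_right_conjugate_iff (Unitary.isUnit_coe (U := U))]
  exact PosDef.diagonal fun i ↦ by simpa [← map_pow, ← map_sub] using hd i

end Matrix

section PosDef

open Matrix

variable {n R : Type*}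

lemma sum_sum_pos_of_posDef [Ring R] [PartialOrder R] [StarRing R] {M : Matrix n n R}
    (hM : M.PosDef) {m : Type*} [Fintype m] {g : m → n} (hg : g.Injective) {z : m → R}
    (hz : z ≠ 0) : 0 < ∑ i, ∑ j, star (z i) * M (g i) (g j) * z j := by
  simpa [dotProduct, mulVec, Finset.mul_sum, mul_assoc] using
    (hM.submatrix hg).dotProduct_mulVec_pos hz

variable [CommRing R] [LinearOrder R] [IsStrictOrderedRing R] [StarRing R] [TrivialStar R]
  {M : Matrix n n R}

lemma two_mul_apply_lt_of_posDef (hM : M.PosDef) {u v : n} (huv : u ≠ v) :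
    2 * M u v < M u u + M v v := by
  have hsymm : M v u = M u v := by simpa using hM.isHermitian.apply u v
  have hinj : Function.Injective ![u, v] := by
    simp [Function.Injective, Fin.forall_fin_two, huv, huv.symm]
  have hpos := sum_sum_pos_of_posDef hM hinj (z := ![1, -1]) fun h0 ↦ by simpa using congrFun h0 0
  simp only [Fin.sum_univ_two, cons_val, star_trivial, hsymm] at hpos
  linarith

lemma apply_pos_of_posDef (hM : M.PosDef) {e f p : n} (hfp : f ≠ p) (he : M e e = 1)
    (hf : M f f = 2) (hp : M p p = 2) (hMef : M e f = 1) (hMep : M e p = 1) : 0 < M f p := by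
  have hsymm (i j : n) : M j i = M i j := by simpa using hM.isHermitian.apply i j
  have hef : e ≠ f := by rintro rfl; norm_num [he] at hf
  have hep : e ≠ p := by rintro rfl; norm_num [he] at hp
  have hinj : Function.Injective ![f, p, e] := by
    simp [Function.Injective, Fin.forall_fin_succ, hef, hep, hfp, hef.symm, hep.symm, hfp.symm]
  -- The test vector is the sum of the components `f - e` and `p - e` of `f` and `p` orthogonal
  -- to `e`.
  have hpos := sum_sum_pos_of_posDef hM hinj (z := ![1, 1, -2]) fun h0 ↦ by
    simpa using congrFun h0 0
  simp only [Fin.sum_univ_three, cons_val, star_trivial, hsymm e f, hsymm e p, hsymm f p, he, hf,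
    hp, hMef, hMep] at hpos
  linarith

lemma two_mul_apply_add_apply_lt_of_posDef (hM : M.PosDef) {e f p x : n} (hfp : f ≠ p)
    (hxf : x ≠ f) (hxp : x ≠ p) (he : M e e = 1) (hf : M f f = 2) (hp : M p p = 2)
    (hMef : M e f = 1) (hMep : M e p = 1) (hMxe : M x e = 0) :
    2 * (M x f + M x p) < M x x + 2 * M f p := by
  have hsymm (i j : n) : M j i = M i j := by simpa using hM.isHermitian.apply i j
  have hef : e ≠ f := by rintro rfl; norm_num [he] at hf
  have hep : e ≠ p := by rintro rfl; norm_num [he] at hp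
  have hxe : x ≠ e := by rintro rfl; simp [he] at hMxe
  have hinj : Function.Injective ![x, f, p, e] := by
    simp [Function.Injective, Fin.forall_fin_succ, hef, hep, hfp, hxf, hxp, hxe, hef.symm,
      hep.symm, hfp.symm, hxf.symm, hxp.symm, hxe.symm]
  -- The test vector is `x - (f - e) - (p - e)`, where `f - e` and `p - e` are the components
  -- orthogonal to `e`.
  have hpos := sum_sum_pos_of_posDef hM hinj (z := ![1, -1, -1, 2]) fun h0 ↦ by
    simpa using congrFun h0 0
  simp only [Fin.sum_univ_four, cons_val, star_trivial, hsymm e f, hsymm e p, hsymm f p,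
    hsymm x e, hsymm x f, hsymm x p, he, hf, hp, hMef, hMep, hMxe] at hpos
  linarith

end PosDef

section Antitone

variable {α : Type*} [AddCommGroup α] [LinearOrder α] [IsOrderedAddMonoid α] {m : ℕ} {f : Fin m → α}

lemma abs_le_abs_of_antitone_of_rev (hf : Antitone f) (hrev : ∀ k, f k.rev = -f k) {i : Fin m}
    (hle : i ≤ i.rev) (hsucc : (i.rev : ℕ) ≤ i + 1) (k : Fin m) : |f i| ≤ |f k| := by
  have hi : 0 ≤ f i := neg_le_self_iff.1 (hrev i ▸ hf hle)
  rcases le_or_gt k i with hki | hik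
  · exact abs_le_abs_of_nonneg hi (hf hki)
  · have hk : f k ≤ -f i := hrev i ▸ hf (Fin.le_def.2 (hsucc.trans hik))
    rw [abs_of_nonneg hi]
    exact (le_neg_of_le_neg hk).trans (neg_le_abs _)

end Antitone

section Graph

open SimpleGraph Finset

variable {V : Type*} [Fintype V] [DecidableEq V] {G : SimpleGraph V} [DecidableRel G.Adj]

lemma charpoly_neg_adjMatrix {R : Type*} [CommRing R] (hG : G.IsBipartite) :
    (-G.adjMatrix R).charpoly = (G.adjMatrix R).charpoly := by
  obtain ⟨C⟩ := hG
  let S : Matrix V V R := Matrix.diagonal fun v ↦ if C v = 0 then 1 else -1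
  have hS : S * S = 1 := by
    rw [Matrix.diagonal_mul_diagonal, ← Matrix.diagonal_one]
    congr! 2 with v
    split_ifs <;> simp
  have hneg : -G.adjMatrix R = S * G.adjMatrix R * S := by
    ext u v
    rw [Matrix.mul_diagonal, Matrix.diagonal_mul]
    by_cases huv : G.Adj u v
    · have hcolor : C u = 0 ↔ C v ≠ 0 := by have := C.valid huv; omega
      by_cases hv : C v = 0 <;> simp [huv, hv, hcolor]
    · simp [huv]
  rw [hneg, mul_assoc, Matrix.charpoly_mul_comm, mul_assoc, hS, mul_one]

lemma hlIndex_le_abs_eigenvalues [Nonempty V] (hG : G.IsBipartite) (v : V) :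
    G.hlIndex ≤ |(G.isHermitian_adjMatrix ℝ).eigenvalues v| := by
  have hA := G.isHermitian_adjMatrix ℝ
  have hrev := eigenvalues₀_rev hA (charpoly_neg_adjMatrix hG)
  have hpos : 0 < Fintype.card V := Fintype.card_pos
  let i : Fin (Fintype.card V) := ⟨(Fintype.card V + 1) / 2 - 1, by omega⟩
  have hi : (i.rev : ℕ) = (Fintype.card V + 2) / 2 - 1 := by
    simp only [Fin.val_rev, i]
    omega
  have hhl : G.hlIndex = |hA.eigenvalues₀ i| := by
    have hmax : G.hlIndex = max |hA.eigenvalues₀ i| |hA.eigenvalues₀ i.rev| := by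
      simp only [hlIndex, nthEigenvalue, ← hi, Fin.eta, i]
    rw [hmax, hrev, abs_neg, max_self]
  rw [hhl]
  refine abs_le_abs_of_antitone_of_rev hA.eigenvalues₀_antitone hrev ?_ ?_ _
  · rw [Fin.le_def, hi]
    simp only [i]
    omega
  · simp only [hi, i]
    omega

variable (G) in
/-- The number of common neighbours of two vertices. -/
def codegree (u v : V) : ℕ := #(G.neighborFinset u ∩ G.neighborFinset v)

lemma codegree_self (u : V) : codegree G u u = G.degree u := by
  simp [codegree]

lemma codegree_comm (u v : V) : codegree G u v = codegree G v u := by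
  simp [codegree, inter_comm]

lemma codegree_pos_iff {u v : V} : 0 < codegree G u v ↔ ∃ w, G.Adj u w ∧ G.Adj v w := by
  simp [codegree, card_pos, Finset.Nonempty]

lemma eq_of_codegree_le_one {u v a b : V} (huv : codegree G u v ≤ 1) (hua : G.Adj u a)
    (hva : G.Adj v a) (hub : G.Adj u b) (hvb : G.Adj v b) : a = b :=
  card_le_one.1 huv a (by simp [hua, hva]) b (by simp [hub, hvb])

omit [DecidableEq V] in
lemma exists_adj_notMem {v : V} {s : Finset V} (hs : #s < G.degree v) :
    ∃ a, G.Adj v a ∧ a ∉ s := by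
  obtain ⟨a, hav, has⟩ := exists_mem_notMem_of_card_lt_card hs
  exact ⟨a, (G.mem_neighborFinset v a).1 hav, has⟩

lemma adjMatrix_sq_apply {R : Type*} [Semiring R] (u v : V) :
    (G.adjMatrix R ^ 2) u v = codegree G u v := by
  simp [sq, codegree, adjMatrix_apply, ← filter_mem_eq_inter, inter_comm (G.neighborFinset u)]

lemma degree_le_degree_of_codegree_le_one (hC4 : ∀ ⦃u v⦄, u ≠ v → codegree G u v ≤ 1) {e l : V}
    (hel : ¬ G.Adj e l) (hl : ∀ y, G.Adj l y → 0 < codegree G y e) :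
    G.degree l ≤ G.degree e := by
  simp only [codegree_pos_iff] at hl
  choose! w hyw hew using hl
  rw [← card_neighborFinset_eq_degree, ← card_neighborFinset_eq_degree]
  refine card_le_card_of_injOn w (fun y hy ↦ by simpa using hew y (by simpa using hy)) ?_
  intro y hy y' hy' hww
  simp only [coe_neighborFinset, mem_neighborSet] at hy hy'
  have hlw : l ≠ w y := fun hlw ↦ hel (hlw ▸ hew y hy)
  exact eq_of_codegree_le_one (hC4 hlw) hy (hyw y hy).symm hy' (hww ▸ (hyw y' hy').symm)

variable (G) in
/-- The matrix `A² - d` of the adjacency matrix `A`. It is an integer matrix when `d` is an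
integer, and is then used as the Gram matrix of an integral lattice. -/
def shiftedSqAdjMatrix (d : ℝ) : Matrix V V ℝ := G.adjMatrix ℝ ^ 2 - d • 1

lemma shiftedSqAdjMatrix_self (d : ℝ) (u : V) : shiftedSqAdjMatrix G d u u = G.degree u - d := by
  simp [shiftedSqAdjMatrix, adjMatrix_sq_apply, codegree_self]

lemma shiftedSqAdjMatrix_of_ne (d : ℝ) {u v : V} (huv : u ≠ v) :
    shiftedSqAdjMatrix G d u v = codegree G u v := by
  simp [shiftedSqAdjMatrix, adjMatrix_sq_apply, huv]

variable (G) in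
/-- Every adjacency eigenvalue of `G` has square larger than `d`, encoded as the positive
definiteness of `A² - d` so that it can be tested on integer vectors. -/
def SpectrumSqGT (d : ℝ) : Prop := (shiftedSqAdjMatrix G d).PosDef

lemma spectrumSqGT_of_sqrt_lt_hlIndex [Nonempty V] (hG : G.IsBipartite) {d : ℝ}
    (hd : √d < G.hlIndex) : SpectrumSqGT G d := by
  refine posDef_sq_sub_smul_one (G.isHermitian_adjMatrix ℝ) fun v ↦ ?_
  rw [← sq_abs]
  exact Real.lt_sq_of_sqrt_lt (hd.trans_le (hlIndex_le_abs_eigenvalues hG v))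

namespace SpectrumSqGT

variable {D : ℕ}

lemma lt_degree (h : SpectrumSqGT G D) (u : V) : D < G.degree u := by
  have hpos := h.diag_pos (i := u)
  rw [shiftedSqAdjMatrix_self, sub_pos] at hpos
  exact_mod_cast hpos

lemma two_mul_codegree_add_lt (h : SpectrumSqGT G D) {u v : V} (huv : u ≠ v) :
    2 * codegree G u v + 2 * D < G.degree u + G.degree v := by
  have hlt := two_mul_apply_lt_of_posDef h huv
  rw [shiftedSqAdjMatrix_self, shiftedSqAdjMatrix_self, shiftedSqAdjMatrix_of_ne _ huv] at hlt
  have hcast : (2 * codegree G u v + 2 * D : ℝ) < G.degree u + G.degree v := by linarith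
  exact_mod_cast hcast

lemma codegree_le_one (h : SpectrumSqGT G D) (hmax : ∀ v, G.degree v ≤ D + 2) {u v : V}
    (huv : u ≠ v) : codegree G u v ≤ 1 := by
  have := h.two_mul_codegree_add_lt huv
  have := hmax u
  have := hmax v
  omega

lemma degree_eq_of_codegree_pos (h : SpectrumSqGT G D) (hmax : ∀ v, G.degree v ≤ D + 2) {u v : V}
    (huv : u ≠ v) (hdeg : G.degree u ≤ D + 1) (hcodeg : 0 < codegree G u v) :
    G.degree v = D + 2 := by
  have := h.two_mul_codegree_add_lt huv
  have := hmax v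
  omega

variable (h : SpectrumSqGT G D) (hmax : ∀ v, G.degree v ≤ D + 2) {e f p : V}
  (he : G.degree e = D + 1)

include h hmax he

lemma shiftedSqAdjMatrix_eq_of_codegree_pos (hef : e ≠ f) (hcodeg : 0 < codegree G e f) :
    shiftedSqAdjMatrix G D f f = 2 ∧ shiftedSqAdjMatrix G D e f = 1 := by
  have hf : G.degree f = D + 2 := h.degree_eq_of_codegree_pos hmax hef he.le hcodeg
  have hone : codegree G e f = 1 := (h.codegree_le_one hmax hef).antisymm hcodeg
  constructor
  · simp [shiftedSqAdjMatrix_self, hf]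
  · simp [shiftedSqAdjMatrix_of_ne _ hef, hone]

lemma codegree_pos_of_codegree_pos (hef : e ≠ f) (hep : e ≠ p) (hfp : f ≠ p)
    (hcf : 0 < codegree G e f) (hcp : 0 < codegree G e p) : 0 < codegree G f p := by
  obtain ⟨hMf, hMef⟩ := h.shiftedSqAdjMatrix_eq_of_codegree_pos hmax he hef hcf
  obtain ⟨hMp, hMep⟩ := h.shiftedSqAdjMatrix_eq_of_codegree_pos hmax he hep hcp
  have hMe : shiftedSqAdjMatrix G D e e = 1 := by simp [shiftedSqAdjMatrix_self, he]
  have hpos := apply_pos_of_posDef h hfp hMe hMf hMp hMef hMep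
  rw [shiftedSqAdjMatrix_of_ne _ hfp] at hpos
  exact_mod_cast hpos

lemma codegree_pos_of_two_codegree_pos {x : V} (hef : e ≠ f) (hep : e ≠ p) (hfp : f ≠ p)
    (hcf : 0 < codegree G e f) (hcp : 0 < codegree G e p) (hxf : 0 < codegree G x f)
    (hxp : 0 < codegree G x p) : 0 < codegree G x e := by
  by_contra! hxe
  rw [Nat.le_zero] at hxe
  have hne_f : x ≠ f := by rintro rfl; rw [codegree_comm] at hxe; omega
  have hne_p : x ≠ p := by rintro rfl; rw [codegree_comm] at hxe; omega
  have hne_e : x ≠ e := by rintro rfl; rw [codegree_self] at hxe; omega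
  obtain ⟨hMf, hMef⟩ := h.shiftedSqAdjMatrix_eq_of_codegree_pos hmax he hef hcf
  obtain ⟨hMp, hMep⟩ := h.shiftedSqAdjMatrix_eq_of_codegree_pos hmax he hep hcp
  have hMe : shiftedSqAdjMatrix G D e e = 1 := by simp [shiftedSqAdjMatrix_self, he]
  have hMxe : shiftedSqAdjMatrix G D x e = 0 := by simp [shiftedSqAdjMatrix_of_ne _ hne_e, hxe]
  have hlt :=
    two_mul_apply_add_apply_lt_of_posDef h hfp hne_f hne_p hMe hMf hMp hMef hMep hMxe
  rw [shiftedSqAdjMatrix_self, shiftedSqAdjMatrix_of_ne _ hne_f, shiftedSqAdjMatrix_of_ne _ hne_p,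
    shiftedSqAdjMatrix_of_ne _ hfp] at hlt
  have hcast : (2 * (codegree G x f + codegree G x p) + D : ℝ) <
      G.degree x + 2 * codegree G f p := by linarith
  have := hmax x
  have := h.codegree_le_one hmax hfp
  norm_cast at hcast
  omega

lemma degree_le_of_adj_adj {a b l : V} (hab : a ≠ b) (hea : G.Adj e a) (heb : G.Adj e b)
    (hef : e ≠ f) (hfa : G.Adj f a) (hep : e ≠ p) (hpb : G.Adj p b) (hfl : G.Adj f l)
    (hpl : G.Adj p l) : G.degree l ≤ D + 1 := by
  have hC4 {u v a b : V} (huv : u ≠ v) := eq_of_codegree_le_one (a := a) (b := b)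
    (h.codegree_le_one hmax huv)
  have hel : ¬ G.Adj e l := fun hel ↦
    hab ((hC4 hef hea hfa hel hfl).trans (hC4 hep heb hpb hel hpl).symm)
  have hfp : f ≠ p := by rintro rfl; exact hab (hC4 hef hea hfa heb hpb)
  rw [← he]
  refine degree_le_degree_of_codegree_le_one (fun _ _ ↦ h.codegree_le_one hmax) hel fun y hly ↦ ?_
  exact h.codegree_pos_of_two_codegree_pos hmax he hef hep hfp
    (codegree_pos_iff.2 ⟨a, hea, hfa⟩) (codegree_pos_iff.2 ⟨b, heb, hpb⟩)
    (codegree_pos_iff.2 ⟨l, hly.symm, hfl⟩) (codegree_pos_iff.2 ⟨l, hly.symm, hpl⟩)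

lemma exists_adj_adj_degree_le {a b : V} (hab : a ≠ b) (hea : G.Adj e a) (heb : G.Adj e b)
    (hef : e ≠ f) (hfa : G.Adj f a) (hep : e ≠ p) (hpb : G.Adj p b) :
    ∃ l, G.Adj f l ∧ G.Adj p l ∧ G.degree l ≤ D + 1 := by
  have hfp : f ≠ p := by
    rintro rfl
    exact hab (eq_of_codegree_le_one (h.codegree_le_one hmax hef) hea hfa heb hpb)
  obtain ⟨l, hfl, hpl⟩ := codegree_pos_iff.1 <| h.codegree_pos_of_codegree_pos hmax he hef hep hfp
    (codegree_pos_iff.2 ⟨a, hea, hfa⟩) (codegree_pos_iff.2 ⟨b, heb, hpb⟩)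
  exact ⟨l, hfl, hpl, h.degree_le_of_adj_adj hmax he hab hea heb hef hfa hep hpb hfl hpl⟩

omit he

lemma exists_adj_degree_eq (hD : 1 ≤ D) (v : V) : ∃ b, G.Adj v b ∧ G.degree b = D + 2 := by
  have hv : D < G.degree v := h.lt_degree v
  obtain ⟨a, ha, -⟩ := exists_adj_notMem (G := G) (v := v) (s := ∅) (by rw [card_empty]; omega)
  obtain ⟨b, hb, hba⟩ := exists_adj_notMem (G := G) (v := v) (s := {a})
    (by rw [card_singleton]; omega)
  rcases Nat.lt_or_eq_of_le (hmax a) with hdeg | hdeg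
  · exact ⟨b, hb, h.degree_eq_of_codegree_pos hmax (by simpa [eq_comm] using hba) (by omega)
      (codegree_pos_iff.2 ⟨v, ha.symm, hb.symm⟩)⟩
  · exact ⟨a, ha, hdeg⟩

theorem isRegularOfDegree (hD : 1 ≤ D) : G.IsRegularOfDegree (D + 2) := by
  intro e
  by_contra hne
  have hlt : ∀ v, D < G.degree v := h.lt_degree
  have he : G.degree e = D + 1 := by have := hlt e; have := hmax e; omega
  obtain ⟨b, heb, hb⟩ := h.exists_adj_degree_eq hmax hD e
  obtain ⟨a, hea, hab⟩ := exists_adj_notMem (G := G) (v := e) (s := {b})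
    (by rw [card_singleton]; omega)
  obtain ⟨f, haf, hfe⟩ := exists_adj_notMem (G := G) (v := a) (s := {e})
    (by have := hlt a; rw [card_singleton]; omega)
  obtain ⟨p, hbp, hpe⟩ := exists_adj_notMem (G := G) (v := b) (s := {e})
    (by rw [card_singleton]; omega)
  obtain ⟨q, hbq, hqep⟩ := exists_adj_notMem (G := G) (v := b) (s := {e, p})
    (card_le_two.trans_lt (by omega))
  simp only [mem_insert, mem_singleton, not_or, ← ne_eq] at hab hfe hpe hqep
  obtain ⟨hqe, hqp⟩ := hqep
  obtain ⟨l, hfl, hpl, hl⟩ :=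
    h.exists_adj_adj_degree_le hmax he hab hea heb hfe.symm haf.symm hpe.symm hbp.symm
  obtain ⟨m, hfm, hqm, hm⟩ :=
    h.exists_adj_adj_degree_le hmax he hab hea heb hfe.symm haf.symm hqe.symm hbq.symm
  have hfb : ¬ G.Adj f b := fun hfb ↦ hab <|
    eq_of_codegree_le_one (h.codegree_le_one hmax hfe) haf.symm hea hfb heb
  have hlm : l ≠ m := by
    rintro rfl
    have hbl : b = l := eq_of_codegree_le_one (h.codegree_le_one hmax hqp) hbq.symm hbp.symm hqm hpl
    exact hfb (hbl ▸ hfl)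
  have hmdeg : G.degree m = D + 2 :=
    h.degree_eq_of_codegree_pos hmax hlm hl (codegree_pos_iff.2 ⟨f, hfl.symm, hfm.symm⟩)
  omega

end SpectrumSqGT

end Graph

end HLIndex

theorem theorem2p3_general {V : Type*} [Fintype V] [DecidableEq V] [Nonempty V]
    (G : SimpleGraph V) [DecidableRel G.Adj] (hbip : G.IsBipartite) {d : ℕ} (hd : 3 ≤ d)
    (hdeg : ∀ v, G.degree v ≤ d) (hnonreg : ¬ G.IsRegularOfDegree d) :
    G.hlIndex ≤ Real.sqrt ((d : ℝ) - 2) := by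
  by_contra! hlt
  obtain ⟨D, rfl⟩ := Nat.exists_eq_add_of_le' (show 2 ≤ d by omega)
  have hspec : HLIndex.SpectrumSqGT G D :=
    HLIndex.spectrumSqGT_of_sqrt_lt_hlIndex hbip (by simpa using hlt)
  exact hnonreg (hspec.isRegularOfDegree hdeg (by omega))

theorem theorem2p3 {V : Type*} [Fintype V] [DecidableEq V] [Nonempty V]
    (G : SimpleGraph V) [DecidableRel G.Adj]
    (hconn : G.Connected) (hbip : G.IsBipartite)
    (hnonreg : ¬ ∃ k : ℕ, G.IsRegularOfDegree k)
    (hΔ : 3 ≤ G.maxDegree) :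
    G.hlIndex ≤ Real.sqrt ((G.maxDegree : ℝ) - 2) :=
  theorem2p3_general G hbip hΔ G.degree_le_maxDegree fun h ↦ hnonreg ⟨_, h⟩
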